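/- Let $X,Y$ be locally convex Hausdorff real topological vector spaces, $Z$ a normed space, $K\subsetneq Y$ a closed convex cone with nonempty interior, $S\subset Z$ a nonempty closed convex cone, $S^+=\{z^*\in Z^*: z^*(s)\ge 0\ \forall s\in S\}$ (and $K^+$ likewise), and let $\mathcal U$ be a nonempty compact topological space. Write $V^\bullet=V\cup\{-\infty_V,+\infty_V\}$, with $-\infty_V$ smallest and $+\infty_V$ greatest. Let $C\subset X$, and let $F:X\to Y^\bullet$ and $G_u:X\to Z^\bullet$ ($u\in\mathcal U$) be proper (never $-\infty$ and not identically $+\infty$). Put $\operatorname{dom}F=\{x:F(x)\neq+\infty_Y\}$ and $A=\{x\in C: G_u(x)\in -S\ \forall u\in\mathcal U\}$, and assume $A\cap\operatorname{dom}F\neq\emptyset$. For $z^*\in Z^*$, $(z^*\circ G_u)(x)=z^*(G_u(x))$ if $G_u(x)\in Z$, and $(z^*\circ G_u)(x)=+\infty$ if $G_u(x)=+\infty_Z$ (also when $z^*=0$); $y^*\circ F$ is defined likewise. Sums with a term $+\infty$ (and no term $-\infty$) equal $+\infty$, and $(+\infty)k=+\infty_Y$ for $k\in Y$. Weak order and weak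 extrema: for $y_1,y_2\in Y$, $y_1<_K y_2$ means $y_1-y_2\in-\operatorname{int}K$; moreover $-\infty_Y<_K y<_K+\infty_Y$ for $y\in Y$, and $-\infty_Y<_K+\infty_Y$. For $M\subset Y^\bullet$, $\operatorname{WInf}M$ is the set of all $\bar v\in Y^\bullet$ such that $v\not<_K\bar v$ for all $v\in M$, and for every $\tilde v\in Y^\bullet$ with $\bar v<_K\tilde v$ there is $v\in M$ with $v<_K\tilde v$; $\operatorname{WSup}M$ is defined symmetrically, and $\operatorname{WMax}M=M\cap\operatorname{WSup}M$. Assume: - $(\mathcal H_0)$ $C$ is nonempty, closed and convex; the epigraph $\{(x,y)\in X\times Y: y\in F(x)+K\}$ is convex, and $y^*\circ F$ is lower semicontinuous for all $y^*\in K^+\setminus\{0\}$; for each $u\in\mathcal U$ the set $\{(x,z)\in X\times Z: z\in G_u(x)+S\}$ is convex and closed. - $(\mathcal H_1)$ For all $z_1^*,z_2^*\in S^+$ and $u_1,u_2\in\mathcal U$ there are $z^*\in S^+$ and $u\in\mathcal U$ with $(z_1^*\circ G_{u_1})(x)+(z_2^*\circ G_{u_2})(x)\le(z^*\circ G_u)(x)$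 for all $x\in C\cap\operatorname{dom}F$. - $(\mathcal H_2)$ For each $x\in C\cap\operatorname{dom}F$, every net $(z^*_\alpha,u_\alpha,r_\alpha)$ in $S^+\times\mathcal U\times\mathbb R$ and every $(z^*,u,r)\in S^+\times\mathcal U\times\mathbb R$: if $(z^*_\alpha\circ G_{u_\alpha})(x)\ge r_\alpha$ for all $\alpha$, $z^*_\alpha\to z^*$ weak*, $u_\alpha\to u$ and $r_\alpha\to r$, then $(z^*\circ G_u)(x)\ge r$. - $(C_0)$ For every $u\in\mathcal U$ there is $x_u\in C\cap\operatorname{dom}F$ with $G_u(x_u)\in-\operatorname{int}S$. Then for every $k\in\operatorname{int}K$ robust strong stable duality holds for the pair $(\mathrm{RVP})$–$(\mathrm{RVD}^k)$; that is, for every continuous linear map $L:X\to Y$, $$\operatorname{WMax}\Big(\bigcup_{(z^*,u)\in S^+\times\mathcal U}\operatorname{WInf}\{F(x)-L(x)+(z^*\circ G_u)(x)\,k: x\in C\}\Big)=\operatorname{WInf}\{F(x)-L(x): x\in A\}.$$ -/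

import Mathlib

open Set Filter Topology

universe v w

namespace RVO

/-- The extended space obtained from `V` by attaching a smallest element `-∞` and a greatest
element `+∞`. -/
inductive Extended (V : Type*) where
  | negInf : Extended V
  | fin : V → Extended V
  | posInf : Extended V

namespace Extended

/-- Addition on the extended space. The sums of `-∞` and `+∞` are never used for proper mappings;
they get the value `+∞`. -/
def add {V : Type*} [Add V] : Extended V → Extended V → Extended V
  | fin a, fin b => fin (a + b)
  | posInf, _ => posInf
  | _, posInf => posInf
  | negInf, _ => negInf
  | _, negInf => negInf

instance {V : Type*} [Add V] : Add (Extended V) := ⟨add⟩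

/-- The identification of the extended space of `ℝ` with the extended real line. -/
noncomputable def toEReal : Extended ℝ → EReal
  | negInf => ⊥
  | fin r => (r : EReal)
  | posInf => ⊤

/-- `a ↦ a k` for an extended real number `a` and a vector `k`, with `(±∞) k = ±∞`. -/
def smulVec {V : Type*} [SMul ℝ V] : Extended ℝ → V → Extended V
  | negInf, _ => negInf
  | fin r, k => fin (r • k)
  | posInf, _ => posInf

/-- The value `T z` of a map at an extended point. In particular `T (+∞) = +∞`, also for `T = 0`;
the value at `-∞` is never used for proper mappings. -/
def comp {V W : Type*} (T : V → W) : Extended V → Extended W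
  | negInf => negInf
  | fin z => fin (T z)
  | posInf => posInf

end Extended

open Extended

section Order

variable {Y : Type*} [AddCommGroup Y] [TopologicalSpace Y]

/-- The weak ordering `a <_K b` on the extended space: `a - b ∈ - int K` for finite `a`, `b`, and
`-∞ <_K y <_K +∞` for finite `y`, and `-∞ <_K +∞`. -/
def WeakLT (K : Set Y) : Extended Y → Extended Y → Prop
  | _, negInf => False
  | posInf, _ => False
  | negInf, fin _ => True
  | negInf, posInf => True
  | fin _, posInf => True
  | fin a, fin b => -(a - b) ∈ interior K

/-- The weak infimum: the set of weakly infimal elements of `M`. For `M = ∅` it is `{+∞}`. -/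
def wInf (K : Set Y) (M : Set (Extended Y)) : Set (Extended Y) :=
  {a | (∀ b ∈ M, ¬ WeakLT K b a) ∧ ∀ c, WeakLT K a c → ∃ b ∈ M, WeakLT K b c}

/-- The weak supremum: the set of weakly supremal elements of `M`. For `M = ∅` it is `{-∞}`. -/
def wSup (K : Set Y) (M : Set (Extended Y)) : Set (Extended Y) :=
  {a | (∀ b ∈ M, ¬ WeakLT K a b) ∧ ∀ c, WeakLT K c a → ∃ b ∈ M, WeakLT K c b}

/-- The weak maximum: the set of weakly maximal elements of `M`. -/
def wMax (K : Set Y) (M : Set (Extended Y)) : Set (Extended Y) := M ∩ wSup K M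

end Order

/-- The positive dual cone `S⁺` of `S`. -/
def dualCone {V : Type*} [AddCommGroup V] [Module ℝ V] [TopologicalSpace V] (S : Set V) :
    Set (V →L[ℝ] ℝ) :=
  {f | ∀ s ∈ S, 0 ≤ f s}

/-- The extended real value `(f ∘ G)(x)`, for a continuous linear functional `f` and `g = G x`. -/
noncomputable def pairing {V : Type*} [AddCommGroup V] [Module ℝ V] [TopologicalSpace V]
    (f : V →L[ℝ] ℝ) (g : Extended V) : EReal :=
  (comp f g).toEReal

section Mappings

variable {X Y : Type*}

/-- The effective domain. -/
def dom (F : X → Extended Y) : Set X := {x | F x ≠ posInf}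

/-- Proper mappings. -/
def IsProper (F : X → Extended Y) : Prop := (dom F).Nonempty ∧ ∀ x, F x ≠ negInf

/-- The `K`-epigraph `{(x, y) ∈ X × Y : y ∈ F x + K}`. -/
def epi [Add Y] (K : Set Y) (F : X → Extended Y) : Set (X × Y) :=
  {p | ∃ c ∈ K, fin p.2 = F p.1 + fin c}

/-- `K`-convex mappings. -/
def KConvex [AddCommGroup X] [Module ℝ X] [AddCommGroup Y] [Module ℝ Y]
    (K : Set Y) (F : X → Extended Y) : Prop :=
  Convex ℝ (epi K F)

/-- `K`-epi closed mappings. -/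
def KEpiClosed [TopologicalSpace X] [AddCommGroup Y] [TopologicalSpace Y]
    (K : Set Y) (F : X → Extended Y) : Prop :=
  IsClosed (epi K F)

/-- Positively `K`-lower semicontinuous mappings. -/
def PositivelyLSC [TopologicalSpace X] [AddCommGroup Y] [Module ℝ Y] [TopologicalSpace Y]
    (K : Set Y) (F : X → Extended Y) : Prop :=
  ∀ f ∈ dualCone K, f ≠ 0 → LowerSemicontinuous fun x => pairing f (F x)

end Mappings

/-- A uniformly `S⁺`-concave collection `(g i)` of mappings from `U` to the extended space
of `Z`. -/
def UniformlyConcave {Z U I : Type*} [AddCommGroup Z] [Module ℝ Z] [TopologicalSpace Z]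
    (S : Set Z) (g : I → U → Extended Z) : Prop :=
  ∀ z₁ ∈ dualCone S, ∀ z₂ ∈ dualCone S, ∀ u₁ u₂ : U, ∃ z ∈ dualCone S, ∃ u : U, ∀ i,
    pairing z₁ (g i u₁) + pairing z₂ (g i u₂) ≤ pairing z (g i u)

/-- An `S⁺`-uniformly usc mapping `g` from `U` to the extended space of `Z`, through nets; the
functionals converge in the weak* topology, that is, pointwise. The index sets of the nets range
over a universe that is large enough for nets to describe closures in `S⁺ × U × ℝ`. -/
def UniformlyUSC {Z : Type v} {U : Type w} [AddCommGroup Z] [Module ℝ Z] [TopologicalSpace Z]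
    [TopologicalSpace U] (S : Set Z) (g : U → Extended Z) : Prop :=
  ∀ (D : Type (max v w)) [Preorder D] [IsDirectedOrder D] [Nonempty D]
    (zs : D → Z →L[ℝ] ℝ) (us : D → U) (rs : D → ℝ) (z : Z →L[ℝ] ℝ) (u : U) (r : ℝ),
    (∀ a, zs a ∈ dualCone S) → z ∈ dualCone S →
    (∀ a, (rs a : EReal) ≤ pairing (zs a) (g (us a))) →
    (∀ p : Z, Tendsto (fun a => zs a p) atTop (𝓝 (z p))) →
    Tendsto us atTop (𝓝 u) → Tendsto rs atTop (𝓝 r) →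
    (r : EReal) ≤ pairing z (g u)

section Problem

variable {X Y Z U : Type*} [AddCommGroup X] [Module ℝ X] [TopologicalSpace X]
  [AddCommGroup Y] [Module ℝ Y] [TopologicalSpace Y]
  [AddCommGroup Z] [Module ℝ Z] [TopologicalSpace Z]

/-- The robust feasible set `A`: all `x ∈ C` with `G u x ∈ -S` for every `u`. -/
def feasibleSet (S : Set Z) (C : Set X) (G : U → X → Extended Z) : Set X :=
  {x | x ∈ C ∧ ∀ u, ∃ z, -z ∈ S ∧ G u x = fin z}

/-- The perturbed objective `F - L`. -/
def perturb (F : X → Extended Y) (L : X →L[ℝ] Y) : X → Extended Y :=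
  fun x => F x + fin (-(L x))

/-- The set of values of the objective `F` of (RVP) on the feasible set. -/
def primalValues (S : Set Z) (C : Set X) (F : X → Extended Y) (G : U → X → Extended Z) :
    Set (Extended Y) :=
  F '' feasibleSet S C G

/-- The set over which the outer weak supremum of the dual problem is taken: the union over
`(z, u) ∈ S⁺ × U` of the weak infima over `x ∈ C` of `F x + (z ∘ G u)(x) k`. -/
def dualValues (K : Set Y) (S : Set Z) (C : Set X) (F : X → Extended Y)
    (G : U → X → Extended Z) (k : Y) : Set (Extended Y) :=
  ⋃ z ∈ dualCone S, ⋃ u : U, wInf K ((fun x => F x + (comp z (G u x)).smulVec k) '' C)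

/-- Robust strong `𝒱`-stable duality for the problem and its dual with respect to `k`: for each
`L ∈ 𝒱`, the weak maximum of the dual of the problem with objective `F - L` is the weak infimum
of that problem. -/
def StrongStableDualityOn (𝒱 : Set (X →L[ℝ] Y)) (K : Set Y) (S : Set Z) (C : Set X)
    (F : X → Extended Y) (G : U → X → Extended Z) (k : Y) : Prop :=
  ∀ L ∈ 𝒱, wMax K (dualValues K S C (perturb F L) G k) =
    wInf K (primalValues S C (perturb F L) G)

/-- Robust strong stable duality: perturbations by all continuous linear maps. -/
def StrongStableDuality (K : Set Y) (S : Set Z) (C : Set X)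
    (F : X → Extended Y) (G : U → X → Extended Z) (k : Y) : Prop :=
  StrongStableDualityOn univ K S C F G k

end Problem

end RVO

set_option linter.unusedSectionVars false

/-! Weak duality holds because `z (G u x) ≤ 0` for a feasible `x` and `z` in `dualCone S`: adding `z
(G u x) • k` to a feasible value only lowers it with respect to `K`. The substance is the converse,
`exists_forall_lagrangian_not_weakLT`: if no primal value is weakly below a finite `v`, then one
multiplier pair `(z, u)` has no Lagrangian value weakly below `v`.

To prove it, `exists_separating` scalarizes with a functional `φ` that is positive on `interior K`.
For finitely many points, a separating hyperplane in `ι → ℝ` yields a multiplier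
(`exists_multiplier_of_finite`). The Slater points bound the multipliers (`exists_local_bound`).
Weak* compactness of balls, compactness of `U` and the finite intersection property then give one
pair for all points (`exists_multiplier`). Dividing `z` by `φ k` returns to the vector problem.

In `wMax_dualValues_eq` both inclusions follow from these two facts and from moving up along `k` to
a weakly infimal element (`exists_add_smul_mem_wInf`). Replacing `F` by `F - L` preserves convexity
and the domain, so the duality is stable. -/

namespace RVO

open Extended

namespace Extended

/-- The finite value of an element of the extended space, with value `0` at `±∞`. -/
def finPart {V : Type*} [Zero V] : Extended V → V
  | fin z => z
  | _ => 0

@[simp] lemma finPart_fin {V : Type*} [Zero V] (a : V) : finPart (fin a) = a := rfl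

lemma fin_add_fin {V : Type*} [Add V] (a b : V) : (fin a + fin b : Extended V) = fin (a + b) := rfl

lemma posInf_add {V : Type*} [Add V] (a : Extended V) : posInf + a = posInf := rfl

lemma add_posInf {V : Type*} [Add V] (a : Extended V) : a + posInf = posInf := by
  cases a <;> rfl

lemma fin_injective {V : Type*} : Function.Injective (fin : V → Extended V) :=
  fun _ _ h => Extended.fin.inj h

end Extended

/-! ### Interior of a convex cone, weak order and weakly infimal elements -/

section Cone

variable {Y : Type*} [AddCommGroup Y] [Module ℝ Y] [TopologicalSpace Y] [IsTopologicalAddGroup Y]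
  [ContinuousSMul ℝ Y] {K : ProperCone ℝ Y}

lemma add_mem_interior {a b : Y} (ha : a ∈ interior (K : Set Y)) (hb : b ∈ K) :
    a + b ∈ interior (K : Set Y) := by
  have hopen : IsOpen {y : Y | y - b ∈ interior (K : Set Y)} :=
    isOpen_interior.preimage (by fun_prop)
  refine interior_maximal ?_ hopen (by simpa using ha)
  intro y hy
  have : y - b ∈ K := interior_subset hy
  simpa using K.add_mem this hb

lemma smul_mem_interior {a : Y} (ha : a ∈ interior (K : Set Y)) {t : ℝ} (ht : 0 < t) :
    t • a ∈ interior (K : Set Y) := by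
  have hopen : IsOpen {y : Y | t⁻¹ • y ∈ interior (K : Set Y)} :=
    isOpen_interior.preimage (by fun_prop)
  refine interior_maximal ?_ hopen (by simpa [smul_smul, ht.ne'] using ha)
  intro y hy
  have : t⁻¹ • y ∈ K := interior_subset hy
  simpa [smul_smul, ht.ne'] using K.smul_mem this ht.le

lemma exists_pos_add_smul_mem_interior {a : Y} (ha : a ∈ interior (K : Set Y)) (b : Y) :
    ∃ ε > (0 : ℝ), a + ε • b ∈ interior (K : Set Y) := by
  have hc : ContinuousAt (fun ε : ℝ => a + ε • b) 0 := by fun_prop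
  have := hc.preimage_mem_nhds (t := interior (K : Set Y))
    (isOpen_interior.mem_nhds (by simpa using ha))
  obtain ⟨δ, hδ, h⟩ := Metric.mem_nhds_iff.1 this
  refine ⟨δ / 2, by positivity, h ?_⟩
  simp [abs_of_pos hδ, hδ]

/-- From an interior point one can move a little in a direction where `f` decreases and stay in `K`;
a zero value at `a` would become negative. -/
lemma pos_of_mem_interior {f : Y →L[ℝ] ℝ} (hf : f ∈ dualCone (K : Set Y)) {b : Y} (hb : f b ≠ 0)
    {a : Y} (ha : a ∈ interior (K : Set Y)) : 0 < f a := by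
  wlog hb' : f b < 0 generalizing b
  · exact this (b := -b) (by simpa using hb) (by
      have := lt_of_le_of_ne (not_lt.1 hb') hb.symm
      simpa using this)
  obtain ⟨ε, hε, h⟩ := exists_pos_add_smul_mem_interior ha b
  have := hf _ (interior_subset h)
  simp only [map_add, map_smul, smul_eq_mul] at this
  nlinarith [mul_neg_of_pos_of_neg hε hb']

lemma weakLT_fin_fin {a b : Y} :
    WeakLT (K : Set Y) (fin a) (fin b) ↔ b - a ∈ interior (K : Set Y) := by
  rw [← neg_sub a b]; exact Iff.rfl

lemma WeakLT.of_sub_mem {a b : Y} {c : Extended Y} (h : WeakLT (K : Set Y) (fin a) c)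
    (hab : a - b ∈ K) : WeakLT (K : Set Y) (fin b) c := by
  cases c <;> first | exact trivial | exact h.elim | skip
  rw [weakLT_fin_fin] at *
  simpa using add_mem_interior h hab

/-- A point below which there is no element of `M` lies below a weakly infimal element of `M`. -/
lemma exists_add_smul_mem_wInf {M : Set (Extended Y)} {m c k : Y}
    (hk : k ∈ interior (K : Set Y)) (hm : fin m ∈ M)
    (hc : ∀ b ∈ M, ¬ WeakLT (K : Set Y) b (fin c)) :
    ∃ t : ℝ, 0 ≤ t ∧ fin (c + t • k) ∈ wInf (K : Set Y) M := by
  set T : Set ℝ := {t | 0 ≤ t ∧ ∀ a, fin a ∈ M → c + t • k - a ∉ interior (K : Set Y)} with hT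
  have hnegInf : negInf ∉ M := fun h => hc _ h trivial
  have hne : T.Nonempty := ⟨0, le_rfl, fun a ha h =>
    hc _ ha (weakLT_fin_fin.2 (by simpa using h))⟩
  have hclosed : IsClosed T := by
    simp only [hT, Set.ofPred_and, Set.ofPred_forall]
    refine isClosed_Ici.inter (isClosed_iInter fun a => isClosed_iInter fun _ => ?_)
    exact (isOpen_interior.preimage (f := fun t : ℝ => c + t • k - a)
      (by fun_prop)).isClosed_compl
  -- The ray `c + t • k` eventually lies weakly above `m`: `k + ε • (c - m)` is interior for small
  -- `ε`, and scaling by `ε⁻¹` gives the bound.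
  have hbdd : BddAbove T := by
    obtain ⟨ε, hε, h⟩ := exists_pos_add_smul_mem_interior hk (c - m)
    refine ⟨ε⁻¹, fun t ht => ?_⟩
    by_contra! hlt
    refine ht.2 m hm ?_
    have h1 := smul_mem_interior h (inv_pos.2 hε)
    have h2 := add_mem_interior h1
      (K.smul_mem (interior_subset hk : k ∈ K) (sub_nonneg.2 hlt.le))
    convert h2 using 1
    rw [smul_add, smul_smul, inv_mul_cancel₀ hε.ne']
    module
  have hmem := hclosed.csSup_mem hne hbdd
  set t := sSup T
  refine ⟨t, hmem.1, ?_, ?_⟩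
  · intro b hb h
    cases b with
    | negInf => exact hnegInf hb
    | posInf => exact h
    | fin a => exact hmem.2 a hb (weakLT_fin_fin.1 h)
  · intro y hy
    cases y with
    | negInf => exact hy.elim
    | posInf => exact ⟨_, hm, trivial⟩
    | fin y =>
      rw [weakLT_fin_fin] at hy
      -- There is room to climb by `ε • k` and stay weakly below `y`; since `t + ε` exceeds the
      -- supremum, an element of `M` lies weakly below that higher point.
      obtain ⟨ε, hε, h⟩ := exists_pos_add_smul_mem_interior hy (-k)
      have hnot : t + ε ∉ T := fun h' => by linarith [le_csSup hbdd h']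
      simp only [hT, Set.mem_ofPred_eq, not_and, not_forall, not_not] at hnot
      obtain ⟨a, ha, ha'⟩ := hnot (by linarith [hmem.1])
      refine ⟨_, ha, weakLT_fin_fin.2 ?_⟩
      convert add_mem_interior ha' (interior_subset h) using 1
      module

end Cone

/-! ### Convex extended mappings and pairings with functionals -/

section Mappings

variable {X V : Type*} [AddCommGroup X] [Module ℝ X] [AddCommGroup V] [Module ℝ V]
  {F : X → Extended V}

lemma eq_fin_finPart {Ω W : Type*} [Zero W] {H : Ω → Extended W} (hH : ∀ x, H x ≠ negInf) {x : Ω}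
    (hx : x ∈ dom H) : H x = fin (finPart (H x)) := by
  cases h : H x with
  | negInf => exact (hH x h).elim
  | posInf => exact (hx h).elim
  | fin a => rfl

variable [TopologicalSpace V]

/-- The values of a `K`-convex mapping at convex combinations, modulo `K`. -/
lemma KConvex.exists_eq_fin {K : ProperCone ℝ V} (hF : KConvex (K : Set V) F) {x y : X} {p q : V}
    (hx : F x = fin p) (hy : F y = fin q) {a b : ℝ} (ha : 0 ≤ a) (hb : 0 ≤ b) (hab : a + b = 1) :
    ∃ r, F (a • x + b • y) = fin r ∧ a • p + b • q - r ∈ K := by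
  have h1 : (x, p) ∈ epi (K : Set V) F := ⟨0, K.zero_mem, by rw [hx, fin_add_fin, add_zero]⟩
  have h2 : (y, q) ∈ epi (K : Set V) F := ⟨0, K.zero_mem, by rw [hy, fin_add_fin, add_zero]⟩
  obtain ⟨c, hc, h⟩ := hF h1 h2 ha hb hab
  simp only [Prod.smul_mk, Prod.mk_add_mk] at h
  cases hr : F (a • x + b • y) with
  | negInf => rw [hr] at h; cases h
  | posInf => rw [hr] at h; cases h
  | fin r =>
    rw [hr, fin_add_fin] at h
    refine ⟨r, rfl, ?_⟩
    rw [fin_injective h, add_sub_cancel_left]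
    exact hc

lemma KConvex.convex_dom {K : ProperCone ℝ V} (hF : KConvex (K : Set V) F)
    (hF' : ∀ x, F x ≠ negInf) : Convex ℝ (dom F) := by
  intro x hx y hy a b ha hb hab h
  obtain ⟨r, hr, -⟩ := hF.exists_eq_fin (eq_fin_finPart hF' hx) (eq_fin_finPart hF' hy) ha hb hab
  rw [hr] at h
  cases h

lemma KConvex.convexOn {K : ProperCone ℝ V} (hF : KConvex (K : Set V) F)
    (hF' : ∀ x, F x ≠ negInf) {f : V →L[ℝ] ℝ} (hf : f ∈ dualCone (K : Set V)) :
    ConvexOn ℝ (dom F) fun x => f (finPart (F x)) := by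
  refine ⟨hF.convex_dom hF', fun x hx y hy a b ha hb hab => ?_⟩
  obtain ⟨r, hr, h⟩ := hF.exists_eq_fin (eq_fin_finPart hF' hx) (eq_fin_finPart hF' hy) ha hb hab
  have := hf _ h
  simp only [map_sub, map_add, map_smul] at this
  simp only [hr, finPart_fin]
  linarith

lemma le_pairing_fin {f : V →L[ℝ] ℝ} {a : V} {s : ℝ} :
    (s : EReal) ≤ pairing f (fin a) ↔ s ≤ f a := by
  simp [pairing, comp, toEReal]

lemma le_pairing_posInf (f : V →L[ℝ] ℝ) (s : EReal) : s ≤ pairing f posInf := by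
  simp [pairing, comp, toEReal]

lemma le_pairing_smul {f : V →L[ℝ] ℝ} {g : Extended V} (hg : g ≠ negInf) {s a : ℝ} (ha : 0 ≤ a)
    (h : (s : EReal) ≤ pairing f g) : ((a * s : ℝ) : EReal) ≤ pairing (a • f) g := by
  cases g with
  | negInf => exact (hg rfl).elim
  | posInf => exact le_pairing_posInf _ _
  | fin g =>
    rw [le_pairing_fin] at *
    simpa using mul_le_mul_of_nonneg_left h ha

lemma zero_le_pairing_zero {g : Extended V} (hg : g ≠ negInf) :
    ((0 : ℝ) : EReal) ≤ pairing (0 : V →L[ℝ] ℝ) g := by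
  cases g with
  | negInf => exact (hg rfl).elim
  | posInf => exact le_pairing_posInf _ _
  | fin g => rw [le_pairing_fin]; simp

lemma smul_mem_dualCone {S : Set V} {f : V →L[ℝ] ℝ} (hf : f ∈ dualCone S) {a : ℝ} (ha : 0 ≤ a) :
    a • f ∈ dualCone S := fun s hs => by
  simpa using mul_nonneg ha (hf s hs)

lemma zero_mem_dualCone {S : Set V} : (0 : V →L[ℝ] ℝ) ∈ dualCone S := fun s _ => by simp

end Mappings

/-! ### Multipliers for finitely many points -/

/-- A convex subset of `ι → ℝ` without positive vectors lies in a half-space given by weights. -/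
lemma exists_weights {ι : Type*} [Fintype ι] {E : Set (ι → ℝ)} (hE : Convex ℝ E)
    (hne : E.Nonempty) (h : ∀ t ∈ E, ¬ ∀ i, 0 < t i) :
    ∃ μ : ι → ℝ, (∀ i, 0 ≤ μ i) ∧ ∑ i, μ i = 1 ∧ ∀ t ∈ E, ∑ i, μ i * t i ≤ 0 := by
  classical
  have hOeq : {t : ι → ℝ | ∀ i, 0 < t i} = Set.pi univ fun _ => Ioi 0 := by ext; simp
  have hOopen : IsOpen {t : ι → ℝ | ∀ i, 0 < t i} := by
    rw [hOeq]; exact isOpen_set_pi finite_univ fun _ _ => isOpen_Ioi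
  have hOconv : Convex ℝ {t : ι → ℝ | ∀ i, 0 < t i} := by
    rw [hOeq]; exact convex_pi fun _ _ => convex_Ioi 0
  obtain ⟨φ, s, hO, hE'⟩ := geometric_hahn_banach_open hOconv hOopen hE
    (Set.disjoint_left.2 fun t ht ht' => h t ht' ht)
  have hφ : ∀ t : ι → ℝ, φ t = ∑ i, t i * φ (Pi.single i 1) := by
    intro t
    conv_lhs => rw [pi_eq_sum_univ' t, map_sum]
    refine Finset.sum_congr rfl fun i _ => ?_
    rw [map_smul, smul_eq_mul]
  -- The origin is a limit of positive vectors, on which `φ < s`.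
  have hs : 0 ≤ s := by
    by_contra! hs
    have hN : Tendsto (fun δ : ℝ => δ * φ 1) (𝓝[>] 0) (𝓝 (0 * φ 1)) :=
      ((continuous_id.mul continuous_const).tendsto 0).mono_left nhdsWithin_le_nhds
    have : (0 : ℝ) * φ 1 ≤ s := by
      refine le_of_tendsto hN (eventually_mem_nhdsWithin.mono fun δ hδ => ?_)
      have := hO (δ • 1) (fun i => by simpa using hδ)
      simpa using this.le
    linarith
  have hneg : ∀ i, φ (Pi.single i 1) ≤ 0 := by
    intro i
    by_contra! hi
    have := hO (1 + ((|s - φ 1|) / φ (Pi.single i 1)) • Pi.single i 1) (fun j => by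
      have : 0 ≤ (|s - φ 1| / φ (Pi.single i 1)) * (Pi.single i 1 : ι → ℝ) j := by
        refine mul_nonneg (by positivity) ?_
        by_cases hj : j = i <;> simp [hj]
      simp only [Pi.add_apply, Pi.one_apply, Pi.smul_apply, smul_eq_mul]
      linarith)
    rw [map_add, map_smul, smul_eq_mul, div_mul_cancel₀ _ hi.ne'] at this
    linarith [le_abs_self (s - φ 1)]
  set ν : ι → ℝ := fun i => - φ (Pi.single i 1) with hν
  have hν0 : ∀ i, 0 ≤ ν i := fun i => by simpa [hν] using hneg i
  have hpos : 0 < ∑ i, ν i := by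
    refine lt_of_le_of_ne (Finset.sum_nonneg fun i _ => hν0 i) fun h0 => ?_
    have hz := (Finset.sum_eq_zero_iff_of_nonneg fun i _ => hν0 i).1 h0.symm
    have hz' : ∀ t, φ t = 0 := fun t => by
      rw [hφ]
      refine Finset.sum_eq_zero fun i hi => ?_
      have := hz i hi
      simp only [hν, neg_eq_zero] at this
      rw [this, mul_zero]
    obtain ⟨e, he⟩ := hne
    have h1 := hO 1 (fun i => by simp)
    have h2 := hE' e he
    rw [hz'] at h1 h2
    linarith
  refine ⟨fun i => (∑ i, ν i)⁻¹ * ν i, fun i => mul_nonneg (inv_nonneg.2 hpos.le) (hν0 i), ?_, ?_⟩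
  · rw [← Finset.mul_sum, inv_mul_cancel₀ hpos.ne']
  · intro t ht
    have h1 := hE' t ht
    rw [hφ] at h1
    have h2 : ∑ i, (∑ i, ν i)⁻¹ * ν i * t i = -((∑ i, ν i)⁻¹ * ∑ i, t i * φ (Pi.single i 1)) := by
      rw [Finset.mul_sum, ← Finset.sum_neg_distrib]
      refine Finset.sum_congr rfl fun i _ => ?_
      simp only [hν]; ring
    rw [h2, neg_nonpos]
    exact mul_nonneg (inv_nonneg.2 hpos.le) (hs.trans h1)

lemma sum_filter_pos_smul {ι M : Type*} [Fintype ι] [AddCommMonoid M] [Module ℝ M] {μ : ι → ℝ}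
    (hμ : ∀ i, 0 ≤ μ i) (v : ι → M) :
    ∑ i with 0 < μ i, μ i • v i = ∑ i, μ i • v i := by
  refine Finset.sum_subset (Finset.subset_univ _) fun i _ hi => ?_
  have : μ i = 0 := le_antisymm (by simpa using hi) (hμ i)
  rw [this, zero_smul]

section

variable {X U : Type*} {Z : Type*} [AddCommGroup X] [Module ℝ X]
  [AddCommGroup Z] [Module ℝ Z] [TopologicalSpace Z] [IsTopologicalAddGroup Z]
  [ContinuousSMul ℝ Z] [LocallyConvexSpace ℝ Z]

/-- The bipolar theorem with a scaling argument: a functional of the dual cone that is positive at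
`g` would have multiples with arbitrarily large values there. -/
lemma neg_mem_of_forall_le {S : ProperCone ℝ Z} {g : Z} {r : ℝ}
    (h : ∀ z ∈ dualCone (S : Set Z), z g ≤ r) : -g ∈ S := by
  by_contra hg
  obtain ⟨f, hf, hf'⟩ := S.hyperplane_separation_point hg
  rw [map_neg, neg_lt_zero] at hf'
  have h1 := h ((f g)⁻¹ • ((|r| + 1) • f)) (smul_mem_dualCone (smul_mem_dualCone hf (by positivity))
    (inv_nonneg.2 hf'.le))
  simp only [smul_apply, smul_eq_mul] at h1
  rw [mul_left_comm, inv_mul_cancel₀ hf'.ne', mul_one] at h1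
  linarith [le_abs_self r]

/-- For finitely many points, the constraint multipliers attain all values below those that are
compatible with the lower bound `r` of `f` on the feasible points. -/
lemma exists_multiplier_of_finite {S : ProperCone ℝ Z} {D : Set X} {f : X → ℝ}
    {G : U → X → Extended Z} [Nonempty U] (hf : ConvexOn ℝ D f) (hG : ∀ u x, G u x ≠ negInf)
    (hGS : ∀ u, KConvex (S : Set Z) (G u))
    (H1 : UniformlyConcave (S : Set Z) (fun (x : D) (u : U) => G u x)) {r : ℝ}
    (hr : ∀ x ∈ D, (∀ u, ∃ z, -z ∈ S ∧ G u x = fin z) → r ≤ f x)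
    {ι : Type*} [Fintype ι] [Nonempty ι] (x : ι → D) (s : ι → ℝ)
    (hs : ∀ i, s i + f (x i) < r) :
    ∃ z ∈ dualCone (S : Set Z), ∃ u, ∀ i, (s i : EReal) ≤ pairing z (G u (x i)) := by
  classical
  by_contra! hcon
  -- The margins over `s` that some multiplier achieves simultaneously at all points. `H1` makes
  -- this set convex, and `hcon` says that it contains no positive vector.
  set E : Set (ι → ℝ) := {t | ∃ z ∈ dualCone (S : Set Z), ∃ u, ∀ i,
    ((s i + t i : ℝ) : EReal) ≤ pairing z (G u (x i))} with hE
  have hEconv : Convex ℝ E := by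
    rintro t ⟨z₁, hz₁, u₁, h₁⟩ t' ⟨z₂, hz₂, u₂, h₂⟩ a b ha hb hab
    obtain ⟨z, hz, u, h⟩ := H1 _ (smul_mem_dualCone hz₁ ha) _ (smul_mem_dualCone hz₂ hb) u₁ u₂
    refine ⟨z, hz, u, fun i => le_trans ?_ (h (x i))⟩
    have e : s i + (a • t + b • t') i = a * (s i + t i) + b * (s i + t' i) := by
      simp only [Pi.add_apply, Pi.smul_apply, smul_eq_mul]
      linear_combination (-(s i)) * hab
    rw [e, EReal.coe_add]
    exact add_le_add (le_pairing_smul (hG _ _) ha (h₁ i)) (le_pairing_smul (hG _ _) hb (h₂ i))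
  have hzero : ∀ u i, ((0 : ℝ) : EReal) ≤ pairing (0 : Z →L[ℝ] ℝ) (G u (x i)) :=
    fun u i => zero_le_pairing_zero (hG _ _)
  have hEne : E.Nonempty := ⟨fun i => - s i, 0, zero_mem_dualCone, Classical.arbitrary U, fun i => by
    simpa using hzero (Classical.arbitrary U) i⟩
  obtain ⟨μ, hμ, hμ1, hμE⟩ := exists_weights hEconv hEne (by
    rintro t ⟨z, hz, u, h⟩ ht
    obtain ⟨i, hi⟩ := hcon z hz u
    exact hi.not_ge (le_trans (EReal.coe_le_coe_iff.2 (by linarith [ht i])) (h i)))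
  -- Where `G u` is `+∞`, even the zero functional takes the value `+∞`, so the margin there is
  -- unrestricted; a positive weight would violate `hμE`.
  have hdom : ∀ u i, 0 < μ i → (x i : X) ∈ dom (G u) := by
    intro u i hi hinf
    have key := hμE (fun j => - s j + if j = i then (|∑ j, μ j * s j| + 1) / μ i else 0) ⟨0,
      zero_mem_dualCone, u, fun j => by
        by_cases hj : j = i
        · subst hj; rw [hinf]; exact le_pairing_posInf _ _
        · simpa [hj] using hzero u j⟩
    simp only [mul_add, Finset.sum_add_distrib, mul_ite, mul_zero, Finset.sum_ite_eq',
      Finset.mem_univ, if_true, mul_neg, Finset.sum_neg_distrib] at key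
    rw [mul_div_cancel₀ _ hi.ne'] at key
    linarith [le_abs_self (∑ j, μ j * s j)]
  set xb : X := ∑ i, μ i • (x i : X) with hxb
  have hxD : xb ∈ D := hf.1.sum_mem (fun i _ => hμ i) hμ1 fun i _ => (x i).2
  -- Jensen's inequality and `hμE` bound `z (G u xb)` by `∑ i, μ i * s i` uniformly over the dual
  -- cone. Points of weight zero are discarded because they may lie outside `dom (G u)`.
  have hfeas : ∀ u, ∃ g, -g ∈ S ∧ G u xb = fin g := by
    intro u
    have h1 : ∑ i ∈ Finset.univ.filter (fun i => 0 < μ i), μ i = 1 := by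
      simpa [hμ1] using sum_filter_pos_smul hμ (fun _ => (1 : ℝ))
    have hmem : ∀ i ∈ Finset.univ.filter (fun i => 0 < μ i), (x i : X) ∈ dom (G u) :=
      fun i hi => hdom u i (by simpa using hi)
    have hxG : xb ∈ dom (G u) := by
      rw [hxb, ← sum_filter_pos_smul hμ]
      exact ((hGS u).convex_dom (hG u)).sum_mem (fun i _ => hμ i) h1 hmem
    refine ⟨_, ?_, eq_fin_finPart (hG u) hxG⟩
    refine neg_mem_of_forall_le (r := ∑ i, μ i * s i) fun z hz => ?_
    have hJ := ((hGS u).convexOn (hG u) hz).map_sum_le (fun i _ => hμ i) h1 hmem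
    rw [sum_filter_pos_smul hμ, sum_filter_pos_smul hμ] at hJ
    have key := hμE (fun i => z (finPart (G u (x i))) - s i) ⟨z, hz, u, fun i => by
      by_cases hi : (x i : X) ∈ dom (G u)
      · rw [eq_fin_finPart (hG u) hi, le_pairing_fin]; simp
      · rw [not_not.1 hi]; exact le_pairing_posInf _ _⟩
    simp only [mul_sub, Finset.sum_sub_distrib] at key
    simp only [smul_eq_mul] at hJ
    linarith
  have h2 := hr xb hxD hfeas
  have h3 := hf.map_sum_le (fun i _ => hμ i) hμ1 (fun i _ => (x i).2)
  -- The zero multiplier shows that `∑ i, μ i * s i` is nonnegative, so averaging `hs` gives a value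
  -- of `f` at `xb` below `r`.
  have h4 := hμE _ (⟨0, zero_mem_dualCone, Classical.arbitrary U, fun i => by
    simpa using hzero (Classical.arbitrary U) i⟩ : (fun i => - s i) ∈ E)
  have h5 : ∑ i, μ i * (s i + f (x i)) < ∑ i, μ i * r := by
    obtain ⟨j, hj⟩ : ∃ j, 0 < μ j := by
      by_contra! hall
      have : ∑ i, μ i ≤ 0 := Finset.sum_nonpos fun i _ => hall i
      linarith
    exact Finset.sum_lt_sum (fun i _ => mul_le_mul_of_nonneg_left (hs i).le (hμ i))
      ⟨j, Finset.mem_univ _, mul_lt_mul_of_pos_left (hs j) hj⟩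
  rw [← Finset.sum_mul, hμ1, one_mul] at h5
  simp only [mul_add, Finset.sum_add_distrib, mul_neg, Finset.sum_neg_distrib,
    smul_eq_mul] at h3 h4 h5
  linarith

end

/-! ### Weak* compactness of the multipliers -/

section Compactness

variable {X : Type*} {Z : Type v} {U : Type w} [NormedAddCommGroup Z]
  [NormedSpace ℝ Z] [TopologicalSpace U]

/-- The multipliers at which the constraint takes a value of at least `s` form a weak* closed
set. -/
lemma UniformlyUSC.isClosed {S : Set Z} {g : U → Extended Z} (H2 : UniformlyUSC S g) (s : ℝ) :
    IsClosed {p : WeakDual ℝ Z × U | WeakDual.toStrongDual p.1 ∈ dualCone S ∧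
      (s : EReal) ≤ pairing (WeakDual.toStrongDual p.1) (g p.2)} := by
  rw [← closure_subset_iff_isClosed]
  intro p hp
  rw [mem_closure_iff_nhds] at hp
  -- The neighbourhoods of `p` under reverse inclusion index the net; they live in the universe that
  -- `UniformlyUSC` allows.
  let D := OrderDual {V : Set (WeakDual ℝ Z × U) // V ∈ 𝓝 p}
  have : IsDirectedOrder D := ⟨fun a b =>
    ⟨OrderDual.toDual ⟨(OrderDual.ofDual a).1 ∩ (OrderDual.ofDual b).1,
      inter_mem (OrderDual.ofDual a).2 (OrderDual.ofDual b).2⟩, inter_subset_left,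
      inter_subset_right⟩⟩
  have : Nonempty D := ⟨OrderDual.toDual ⟨univ, univ_mem⟩⟩
  choose q hq using fun a : D => hp (OrderDual.ofDual a).1 (OrderDual.ofDual a).2
  have hlim : Tendsto q atTop (𝓝 p) := by
    intro V hV
    refine mem_map.2 (mem_atTop_sets.2 ⟨OrderDual.toDual ⟨V, hV⟩, fun b hb => ?_⟩)
    exact hb (hq b).1
  have h1 : Tendsto (fun a => (q a).1) atTop (𝓝 p.1) := (continuous_fst.tendsto p).comp hlim
  have h2 : Tendsto (fun a => (q a).2) atTop (𝓝 p.2) := (continuous_snd.tendsto p).comp hlim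
  have h3 : ∀ y : Z, Tendsto (fun a => WeakDual.toStrongDual (q a).1 y) atTop
      (𝓝 (WeakDual.toStrongDual p.1 y)) := fun y =>
    ((WeakDual.eval_continuous y).tendsto p.1).comp h1
  have hdual : WeakDual.toStrongDual p.1 ∈ dualCone S := fun y hy =>
    ge_of_tendsto' (h3 y) fun a => (hq a).2.1 y hy
  exact ⟨hdual, H2 D (fun a => WeakDual.toStrongDual (q a).1) (fun a => (q a).2) (fun _ => s) _ _ s
    (fun a => (hq a).2.1) hdual (fun a => (hq a).2.2) h3 h2 tendsto_const_nhds⟩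

/-- At an interior point `e` of `S`, the functionals of the dual cone dominate a multiple of the
norm. -/
lemma exists_pos_mul_norm_le {S : Set Z} {e : Z} (he : e ∈ interior S) :
    ∃ ρ > 0, ∀ z ∈ dualCone S, ρ * ‖z‖ ≤ z e := by
  obtain ⟨ρ, hρ, h⟩ := Metric.mem_nhds_iff.1 (mem_interior_iff_mem_nhds.1 he)
  refine ⟨ρ / 2, by positivity, fun z hz => ?_⟩
  have he0 : 0 ≤ z e := hz e (interior_subset he)
  have hb : ‖z‖ ≤ z e / (ρ / 2) := by
    refine ContinuousLinearMap.opNorm_le_bound _ (by positivity) fun y => ?_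
    rcases eq_or_ne y 0 with rfl | hy
    · simp
    have hy' : 0 < ‖y‖ := norm_pos_iff.2 hy
    -- The points `e ± (ρ / 2 / ‖y‖) • y` lie in the ball, hence in `S`; half the radius keeps them
    -- in the open ball.
    have hball : ∀ a : ℝ, |a| = ρ / 2 / ‖y‖ → 0 ≤ z e + a * z y := fun a ha => by
      have hmem : e + a • y ∈ Metric.ball e ρ := by
        rw [mem_ball_iff_norm, add_sub_cancel_left, norm_smul, Real.norm_eq_abs, ha,
          div_mul_cancel₀ _ hy'.ne']
        linarith
      simpa using hz _ (h hmem)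
    have hpos : 0 < ρ / 2 / ‖y‖ := by positivity
    have h1 := hball _ (abs_of_pos hpos)
    have h2 := hball (-(ρ / 2 / ‖y‖)) (by rw [abs_neg, abs_of_pos hpos])
    have h3 : ρ / 2 / ‖y‖ * |z y| ≤ z e := by
      rcases abs_cases (z y) with ⟨h, -⟩ | ⟨h, -⟩ <;> rw [h] <;> linarith
    rw [Real.norm_eq_abs, div_mul_eq_mul_div, le_div_iff₀ (by positivity)]
    rw [div_mul_eq_mul_div, div_le_iff₀ hy'] at h3
    linarith
  rwa [le_div_iff₀ (by positivity), mul_comm] at hb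

variable [CompactSpace U]

/-- A Slater point for `u₀` bounds the multipliers locally uniformly in `u`. -/
lemma exists_local_bound {S : ProperCone ℝ Z} {G : U → Extended Z} (hG : ∀ u, G u ≠ negInf)
    (H2 : UniformlyUSC (S : Set Z) G) {u₀ : U} {g : Z} (hg : -g ∈ interior (S : Set Z))
    (hGg : G u₀ = fin g) :
    ∃ c > 0, ∀ᶠ u in 𝓝 u₀, ∀ z ∈ dualCone (S : Set Z), ∀ s : ℝ,
      (s : EReal) ≤ pairing z (G u) → c * ‖z‖ ≤ |s| := by
  obtain ⟨ρ, hρ, hρS⟩ := exists_pos_mul_norm_le hg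
  -- Multipliers normalized by `z (-g) = 1` take the value `-1` at `u₀`. Any threshold strictly
  -- between `-1` and `0` would do; upper semicontinuity carries it to nearby `u`, uniformly by the
  -- tube lemma.
  set Q : Set (WeakDual ℝ Z × U) := {p | WeakDual.toStrongDual p.1 ∈ dualCone (S : Set Z) ∧
      ((-(1 / 2) : ℝ) : EReal) ≤ pairing (WeakDual.toStrongDual p.1) (G p.2)} ∩
      {p | WeakDual.toStrongDual p.1 (-g) = 1} with hQ
  have hQclosed : IsClosed Q := (H2.isClosed _).inter
    (isClosed_eq ((WeakDual.eval_continuous (-g)).comp continuous_fst) continuous_const)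
  have htube : (WeakDual.toStrongDual ⁻¹' Metric.closedBall (0 : StrongDual ℝ Z) ρ⁻¹) ×ˢ {u₀} ⊆
      Qᶜ := by
    rintro ⟨z, u⟩ ⟨-, rfl⟩ hz
    have h1 := hz.1.2
    have h2 : WeakDual.toStrongDual z (-g) = 1 := hz.2
    simp only [hGg, le_pairing_fin] at h1
    rw [map_neg] at h2
    linarith
  obtain ⟨V, W, -, hW, hV, hW₀, hVW⟩ := generalized_tube_lemma
    (WeakDual.isCompact_closedBall (𝕜 := ℝ) (0 : StrongDual ℝ Z) ρ⁻¹) isCompact_singleton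
    hQclosed.isOpen_compl htube
  refine ⟨ρ / 2, by positivity, ?_⟩
  filter_upwards [hW.mem_nhds (hW₀ rfl)] with u hu z hz s hs
  rcases eq_or_ne z 0 with rfl | hz0
  · simp
  have hzn : 0 < ‖z‖ := norm_pos_iff.2 hz0
  set a := z (-g) with ha
  have hle : ρ * ‖z‖ ≤ a := hρS z hz
  have hapos : 0 < a := lt_of_lt_of_le (by positivity) hle
  have hmem : (StrongDual.toWeakDual (a⁻¹ • z), u) ∈ Qᶜ := by
    refine hVW ⟨hV ?_, hu⟩
    change a⁻¹ • z ∈ Metric.closedBall (0 : StrongDual ℝ Z) ρ⁻¹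
    rw [mem_closedBall_zero_iff, norm_smul, Real.norm_eq_abs, abs_of_pos (inv_pos.2 hapos),
      inv_mul_le_iff₀ hapos, ← div_eq_mul_inv, le_div_iff₀ hρ, mul_comm]
    exact hle
  have hlt : a⁻¹ * s < -(1 / 2) := by
    by_contra! hcon
    refine hmem ⟨⟨smul_mem_dualCone hz (inv_nonneg.2 hapos.le), ?_⟩, ?_⟩
    · exact (EReal.coe_le_coe_iff.2 hcon).trans
        (le_pairing_smul (hG u) (inv_nonneg.2 hapos.le) hs)
    · change a⁻¹ * z (-g) = 1
      rw [← ha, inv_mul_cancel₀ hapos.ne']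
  rw [inv_mul_lt_iff₀ hapos] at hlt
  linarith [neg_abs_le s]

/-- Attainment in the scalar robust dual problem. -/
theorem exists_multiplier [AddCommGroup X] [Module ℝ X] [Nonempty U] {S : ProperCone ℝ Z}
    {D : Set X} {f : X → ℝ} {G : U → X → Extended Z} (hf : ConvexOn ℝ D f)
    (hG : ∀ u x, G u x ≠ negInf) (hGS : ∀ u, KConvex (S : Set Z) (G u))
    (H1 : UniformlyConcave (S : Set Z) (fun (x : D) (u : U) => G u x))
    (H2 : ∀ x ∈ D, UniformlyUSC (S : Set Z) (fun u => G u x))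
    (C0 : ∀ u, ∃ x ∈ D, ∃ z, -z ∈ interior (S : Set Z) ∧ G u x = fin z) {r : ℝ}
    (hr : ∀ x ∈ D, (∀ u, ∃ z, -z ∈ S ∧ G u x = fin z) → r ≤ f x) :
    ∃ z ∈ dualCone (S : Set Z), ∃ u, ∀ x ∈ D, ∀ s : ℝ, s + f x < r →
      (s : EReal) ≤ pairing z (G u x) := by
  classical
  choose x hxD g hg hGg using C0
  choose c hc hbound using fun u =>
    exists_local_bound (fun v => hG v (x u)) (H2 (x u) (hxD u)) (hg u) (hGg u)
  obtain ⟨T, hT⟩ := CompactSpace.elim_nhds_subcover _ hbound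
  let I := {p : D × ℝ // p.2 + f p.1 < r}
  -- Levels prescribed at the Slater points. Adding those indexed by `T` to every finite subfamily
  -- forces its multipliers into the ball of radius `R`.
  let b : U → I := fun u => ⟨(⟨x u, hxD u⟩, r - 1 - f (x u)), by simp⟩
  set R := ∑ u ∈ T, |r - 1 - f (x u)| / c u with hR
  have hcompact : IsCompact ((WeakDual.toStrongDual ⁻¹' Metric.closedBall (0 : StrongDual ℝ Z) R) ×ˢ
      (univ : Set U)) := (WeakDual.isCompact_closedBall (𝕜 := ℝ) _ R).prod isCompact_univ
  obtain ⟨p, -, hp⟩ := hcompact.inter_iInter_nonempty (fun i : I =>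
    {p : WeakDual ℝ Z × U | WeakDual.toStrongDual p.1 ∈ dualCone (S : Set Z) ∧
      (i.1.2 : EReal) ≤ pairing (WeakDual.toStrongDual p.1) (G p.2 i.1.1)})
    (fun i => (H2 _ i.1.1.2).isClosed _) (by
      intro J
      obtain ⟨v, hv⟩ : T.Nonempty := by
        rw [Finset.nonempty_iff_ne_empty]
        rintro rfl
        have : Classical.arbitrary U ∈ (⊤ : Set U) := trivial
        rw [← hT] at this
        simp at this
      let J' := J ∪ T.image b
      have : Nonempty J' := ⟨⟨b v, Finset.mem_union_right _ (Finset.mem_image_of_mem _ hv)⟩⟩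
      obtain ⟨z, hz, u, h⟩ := exists_multiplier_of_finite hf hG hGS H1 hr
        (fun i : J' => i.1.1.1) (fun i : J' => i.1.1.2) fun i => i.1.2
      refine ⟨(StrongDual.toWeakDual z, u), ⟨?_, mem_univ _⟩, ?_⟩
      · change z ∈ Metric.closedBall (0 : StrongDual ℝ Z) R
        rw [mem_closedBall_zero_iff]
        have hu : u ∈ (⊤ : Set U) := trivial
        rw [← hT] at hu
        simp only [mem_iUnion] at hu
        obtain ⟨v, hv, huv⟩ := hu
        have h1 := huv z hz _ (h ⟨b v, Finset.mem_union_right _ (Finset.mem_image_of_mem _ hv)⟩)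
        have h2 : ‖z‖ ≤ |r - 1 - f (x v)| / c v := by
          rw [le_div_iff₀ (hc v), mul_comm]; exact h1
        refine h2.trans (Finset.single_le_sum
          (f := fun u => |r - 1 - f (x u)| / c u) (fun u _ => ?_) hv)
        exact div_nonneg (abs_nonneg _) (hc u).le
      · simp only [mem_iInter]
        exact fun i hi => ⟨hz, h ⟨i, Finset.mem_union_left _ hi⟩⟩)
  rw [mem_iInter] at hp
  refine ⟨WeakDual.toStrongDual p.1, ?_, p.2, fun y hy s hs => (hp ⟨(⟨y, hy⟩, s), hs⟩).2⟩
  exact (hp (b (Classical.arbitrary U))).1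

end Compactness

/-! ### Scalarization and the duality equality -/

section Duality

variable {X Y : Type*} {Z : Type v} {U : Type w} [AddCommGroup X] [Module ℝ X]
  [AddCommGroup Y] [Module ℝ Y] [TopologicalSpace Y] [IsTopologicalAddGroup Y] [ContinuousSMul ℝ Y]
  [NormedAddCommGroup Z] [NormedSpace ℝ Z]
  {K : ProperCone ℝ Y} {S : ProperCone ℝ Z} {C : Set X} {F : X → Extended Y}
  {G : U → X → Extended Z} {k : Y}

lemma convex_feasibleSet (hC : Convex ℝ C) (hGS : ∀ u, KConvex (S : Set Z) (G u)) :
    Convex ℝ (feasibleSet (S : Set Z) C G) := by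
  rintro x ⟨hx, hxG⟩ y ⟨hy, hyG⟩ a b ha hb hab
  refine ⟨hC hx hy ha hb hab, fun u => ?_⟩
  obtain ⟨p, hp, hxp⟩ := hxG u
  obtain ⟨q, hq, hyq⟩ := hyG u
  obtain ⟨r, hr, hr'⟩ := (hGS u).exists_eq_fin hxp hyq ha hb hab
  refine ⟨r, ?_, hr⟩
  have h := S.add_mem hr' (S.add_mem (S.smul_mem hp ha) (S.smul_mem hq hb))
  rwa [show a • p + b • q - r + (a • -p + b • -q) = -r by module] at h

/-- A point that is not weakly above a primal value is separated from the primal values by a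
functional of the dual cone. -/
lemma exists_separating (hF : ∀ x, F x ≠ negInf) (hFK : KConvex (K : Set Y) F)
    (hC : Convex ℝ C) (hGS : ∀ u, KConvex (S : Set Z) (G u))
    (hA : (feasibleSet (S : Set Z) C G ∩ dom F).Nonempty) (hk : k ∈ interior (K : Set Y)) {v : Y}
    (hv : ∀ b ∈ primalValues (S : Set Z) C F G, ¬ WeakLT (K : Set Y) b (fin v)) :
    ∃ φ ∈ dualCone (K : Set Y), (∀ y ∈ interior (K : Set Y), 0 < φ y) ∧
      ∀ x ∈ feasibleSet (S : Set Z) C G, ∀ y, F x = fin y → φ v ≤ φ y := by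
  -- The feasible values plus `interior K`; unlike the values alone, this set is open and convex.
  set W : Set Y := {w | ∃ x ∈ feasibleSet (S : Set Z) C G, ∃ y, F x = fin y ∧
    w - y ∈ interior (K : Set Y)} with hW
  have hWconv : Convex ℝ W := by
    rintro w₁ ⟨x₁, hx₁, y₁, hy₁, h₁⟩ w₂ ⟨x₂, hx₂, y₂, hy₂, h₂⟩ a b ha hb hab
    obtain ⟨r, hr, hr'⟩ := hFK.exists_eq_fin hy₁ hy₂ ha hb hab
    refine ⟨_, convex_feasibleSet hC hGS hx₁ hx₂ ha hb hab, r, hr, ?_⟩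
    have h := add_mem_interior (K.convex.interior h₁ h₂ ha hb hab) hr'
    convert h using 1
    module
  have hWopen : IsOpen W := by
    have : W = ⋃ x ∈ feasibleSet (S : Set Z) C G, ⋃ y, ⋃ _ : F x = fin y,
        (fun w => w - y) ⁻¹' interior (K : Set Y) := by
      ext w; simp [hW]
    rw [this]
    exact isOpen_biUnion fun x _ => isOpen_iUnion fun y => isOpen_iUnion fun _ =>
      isOpen_interior.preimage (by fun_prop)
  have hvW : v ∉ W := by
    rintro ⟨x, hx, y, hy, h⟩
    exact hv _ ⟨x, hx, hy⟩ (weakLT_fin_fin.2 h)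
  obtain ⟨φ, hφ⟩ := geometric_hahn_banach_point_open hWconv hWopen hvW
  obtain ⟨x₀, hx₀, hx₀F⟩ := hA
  have hy₀ := eq_fin_finPart hF hx₀F
  set y₀ := finPart (F x₀)
  have hw₀ : y₀ + k ∈ W := ⟨x₀, hx₀, y₀, hy₀, by simpa using hk⟩
  have hφw₀ := hφ _ hw₀
  have hφK : φ ∈ dualCone (K : Set Y) := by
    intro c hc
    by_contra! hneg
    -- The coefficient is chosen so that `φ` takes exactly the value `φ v` at this point, against
    -- strict separation.
    have hmem : y₀ + k + ((φ (y₀ + k) - φ v) / (-φ c)) • c ∈ W := by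
      refine ⟨x₀, hx₀, y₀, hy₀, ?_⟩
      rw [add_assoc, add_sub_cancel_left]
      exact add_mem_interior hk (K.smul_mem hc (div_nonneg (by linarith) (by linarith)))
    have h := hφ _ hmem
    rw [map_add _ (y₀ + k), map_smul, smul_eq_mul, div_neg, neg_mul,
      div_mul_cancel₀ _ hneg.ne] at h
    linarith
  have hφpos : ∀ y ∈ interior (K : Set Y), 0 < φ y := fun y hy =>
    pos_of_mem_interior hφK (b := y₀ + k - v) (by rw [map_sub]; linarith) hy
  refine ⟨φ, hφK, hφpos, fun x hx y hy => ?_⟩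
  refine le_of_forall_pos_lt_add fun ε hε => ?_
  have hk' := hφpos k hk
  have h := hφ (y + (ε / φ k) • k) ⟨x, hx, y, hy, by
    rw [add_sub_cancel_left]; exact smul_mem_interior hk (by positivity)⟩
  rwa [map_add, map_smul, smul_eq_mul, div_mul_cancel₀ _ hk'.ne'] at h

/-- The set of values of the Lagrangian for the multiplier `z` and the scenario `u`. -/
def lagrangianValues (C : Set X) (F : X → Extended Y) (G : U → X → Extended Z) (k : Y)
    (z : Z →L[ℝ] ℝ) (u : U) : Set (Extended Y) :=
  (fun x => F x + (comp z (G u x)).smulVec k) '' C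

lemma mem_dualValues {v : Extended Y} :
    v ∈ dualValues (K : Set Y) (S : Set Z) C F G k ↔ ∃ z ∈ dualCone (S : Set Z), ∃ u,
      v ∈ wInf (K : Set Y) (lagrangianValues C F G k z u) := by
  simp only [dualValues, mem_iUnion, exists_prop, lagrangianValues]

lemma lagrangian_eq_fin {z : Z →L[ℝ] ℝ} {u : U} {x : X} {y : Y} {g : Z} (hy : F x = fin y)
    (hg : G u x = fin g) :
    F x + (comp z (G u x)).smulVec k = fin (y + z g • k) := by
  rw [hy, hg]; rfl

/-- Lagrangian values go below whatever a primal value is below. -/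
lemma exists_lagrangian_weakLT (hF : ∀ x, F x ≠ negInf) (hk : k ∈ interior (K : Set Y))
    {z : Z →L[ℝ] ℝ} (hz : z ∈ dualCone (S : Set Z)) (u : U) {b v : Extended Y}
    (hb : b ∈ primalValues (S : Set Z) C F G) (hbv : WeakLT (K : Set Y) b v) :
    ∃ b' ∈ lagrangianValues C F G k z u, WeakLT (K : Set Y) b' v := by
  obtain ⟨x, hx, rfl⟩ := hb
  obtain ⟨g, hg, hxg⟩ := hx.2 u
  have hxF : x ∈ dom F := fun h => by
    rw [h] at hbv
    cases v <;> exact hbv.elim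
  have hy := eq_fin_finPart hF hxF
  refine ⟨_, ⟨x, hx.1, rfl⟩, ?_⟩
  simp only [lagrangian_eq_fin hy hxg]
  rw [hy] at hbv
  refine hbv.of_sub_mem ?_
  have h1 : 0 ≤ -z g := by simpa using hz _ hg
  have h2 := K.smul_mem (interior_subset hk : k ∈ K) h1
  convert h2 using 1
  simp

lemma not_weakLT_of_mem_dualValues (hF : ∀ x, F x ≠ negInf) (hk : k ∈ interior (K : Set Y))
    {b v : Extended Y} (hv : v ∈ dualValues (K : Set Y) (S : Set Z) C F G k)
    (hb : b ∈ primalValues (S : Set Z) C F G) : ¬ WeakLT (K : Set Y) b v := by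
  intro hbv
  obtain ⟨z, hz, u, hv⟩ := mem_dualValues.1 hv
  obtain ⟨b', hb', h⟩ := exists_lagrangian_weakLT hF hk hz u hb hbv
  exact hv.1 _ hb' h

/-- For an element of `M`, the approximation clause of `wSup` is witnessed by the element itself. -/
lemma mem_wMax_iff {M : Set (Extended Y)} {v : Extended Y} :
    v ∈ wMax (K : Set Y) M ↔ v ∈ M ∧ ∀ b ∈ M, ¬ WeakLT (K : Set Y) v b :=
  ⟨fun h => ⟨h.1, h.2.1⟩, fun h => ⟨h.1, h.2, fun _ hc => ⟨v, h.1, hc⟩⟩⟩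

variable [TopologicalSpace U] [CompactSpace U] [Nonempty U]

/-- A point that is not weakly above a primal value is not weakly above the values of some
Lagrangian. -/
theorem exists_forall_lagrangian_not_weakLT (hF : ∀ x, F x ≠ negInf) (hG : ∀ u x, G u x ≠ negInf)
    (hFK : KConvex (K : Set Y) F) (hGS : ∀ u, KConvex (S : Set Z) (G u)) (hC : Convex ℝ C)
    (hA : (feasibleSet (S : Set Z) C G ∩ dom F).Nonempty)
    (H1 : UniformlyConcave (S : Set Z) (fun (x : (C ∩ dom F : Set X)) (u : U) => G u x))
    (H2 : ∀ x ∈ C ∩ dom F, UniformlyUSC (S : Set Z) (fun u => G u x))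
    (C0 : ∀ u, ∃ x ∈ C ∩ dom F, ∃ z, -z ∈ interior (S : Set Z) ∧ G u x = fin z)
    (hk : k ∈ interior (K : Set Y)) {v : Y}
    (hv : ∀ b ∈ primalValues (S : Set Z) C F G, ¬ WeakLT (K : Set Y) b (fin v)) :
    ∃ z ∈ dualCone (S : Set Z), ∃ u, ∀ b ∈ lagrangianValues C F G k z u,
      ¬ WeakLT (K : Set Y) b (fin v) := by
  obtain ⟨φ, hφK, hφpos, hφ⟩ := exists_separating hF hFK hC hGS hA hk hv
  have hf : ConvexOn ℝ (C ∩ dom F) fun x => φ (finPart (F x)) :=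
    (hFK.convexOn hF hφK).subset inter_subset_right (hC.inter (hFK.convex_dom hF))
  obtain ⟨z, hz, u, h⟩ := exists_multiplier hf hG hGS H1 H2 C0 (r := φ v) fun x hx hxG =>
    hφ x ⟨hx.1, hxG⟩ _ (eq_fin_finPart hF hx.2)
  have hk' := hφpos k hk
  -- With this scaling, `φ` sends `((φ k)⁻¹ • z) g • k` to `z g`, which recovers the scalar
  -- Lagrangian.
  refine ⟨(φ k)⁻¹ • z, smul_mem_dualCone hz (inv_nonneg.2 hk'.le), u, ?_⟩
  rintro _ ⟨x, hx, rfl⟩ hlt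
  by_cases hxF : x ∈ dom F
  swap
  · simp only [not_not.1 hxF, posInf_add] at hlt
    exact hlt
  by_cases hxG : x ∈ dom (G u)
  swap
  · simp only [not_not.1 hxG] at hlt
    rw [show (comp _ (posInf : Extended Z)).smulVec k = posInf from rfl, add_posInf] at hlt
    exact hlt
  have hy := eq_fin_finPart hF hxF
  have hg := eq_fin_finPart (hG u) hxG
  simp only [lagrangian_eq_fin hy hg] at hlt
  have hpos := hφpos _ (weakLT_fin_fin.1 hlt)
  have hle : φ v - φ (finPart (F x)) ≤ z (finPart (G u x)) := by
    refine le_of_forall_lt fun s hs => ?_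
    obtain ⟨s', hs1, hs2⟩ := exists_between hs
    have := h x ⟨hx, hxF⟩ s' (by linarith)
    rw [hg, le_pairing_fin] at this
    linarith
  simp only [map_sub, map_add, map_smul, smul_apply, smul_eq_mul] at hpos
  rw [mul_right_comm, inv_mul_cancel₀ hk'.ne', one_mul] at hpos
  linarith

theorem wMax_dualValues_eq (hF : ∀ x, F x ≠ negInf) (hG : ∀ u x, G u x ≠ negInf)
    (hFK : KConvex (K : Set Y) F) (hGS : ∀ u, KConvex (S : Set Z) (G u)) (hC : Convex ℝ C)
    (hA : (feasibleSet (S : Set Z) C G ∩ dom F).Nonempty)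
    (H1 : UniformlyConcave (S : Set Z) (fun (x : (C ∩ dom F : Set X)) (u : U) => G u x))
    (H2 : ∀ x ∈ C ∩ dom F, UniformlyUSC (S : Set Z) (fun u => G u x))
    (C0 : ∀ u, ∃ x ∈ C ∩ dom F, ∃ z, -z ∈ interior (S : Set Z) ∧ G u x = fin z)
    (hk : k ∈ interior (K : Set Y)) :
    wMax (K : Set Y) (dualValues (K : Set Y) (S : Set Z) C F G k) =
      wInf (K : Set Y) (primalValues (S : Set Z) C F G) := by
  obtain ⟨x₀, hx₀, hx₀F⟩ := id hA
  have hy₀ := eq_fin_finPart hF hx₀F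
  set y₀ := finPart (F x₀)
  have hprimal : fin y₀ ∈ primalValues (S : Set Z) C F G := ⟨x₀, hx₀, hy₀⟩
  ext v
  rw [mem_wMax_iff]
  constructor
  · rintro ⟨hvD, hvmax⟩
    refine ⟨fun b hb => not_weakLT_of_mem_dualValues hF hk hvD hb, fun c hvc => ?_⟩
    cases c with
    | negInf => cases v <;> exact hvc.elim
    | posInf => exact ⟨_, hprimal, trivial⟩
    | fin c =>
      -- Otherwise `c` is a lower bound for some Lagrangian; moving up along `k` gives a dual value
      -- still weakly above `v`, against maximality.
      by_contra! hcon
      obtain ⟨z, hz, u, h⟩ :=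
        exists_forall_lagrangian_not_weakLT hF hG hFK hGS hC hA H1 H2 C0 hk hcon
      obtain ⟨g, -, hg⟩ := hx₀.2 u
      obtain ⟨t, ht, hmem⟩ := exists_add_smul_mem_wInf hk
        (⟨x₀, hx₀.1, lagrangian_eq_fin hy₀ hg⟩ : _ ∈ lagrangianValues C F G k z u) h
      refine hvmax _ (mem_dualValues.2 ⟨z, hz, u, hmem⟩) ?_
      cases v with
      | negInf => trivial
      | posInf => exact hvc
      | fin y =>
        rw [weakLT_fin_fin] at *
        have := add_mem_interior hvc (K.smul_mem (interior_subset hk : k ∈ K) ht)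
        convert this using 1
        module
  · rintro ⟨hv1, hv2⟩
    refine ⟨?_, fun w hw hvw => ?_⟩
    · have hbelow : ∀ z ∈ dualCone (S : Set Z), ∀ u : U, ∀ c, WeakLT (K : Set Y) v c →
          ∃ b ∈ lagrangianValues C F G k z u, WeakLT (K : Set Y) b c := by
        intro z hz u c hc
        obtain ⟨b, hb, hbc⟩ := hv2 c hc
        exact exists_lagrangian_weakLT hF hk hz u hb hbc
      rw [mem_dualValues]
      cases v with
      | posInf => exact (hv1 _ hprimal trivial).elim
      -- Nothing lies weakly below `-∞`, so any multiplier serves.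
      | negInf =>
        exact ⟨0, zero_mem_dualCone, Classical.arbitrary U, fun b _ h => by cases b <;> exact h,
          hbelow _ zero_mem_dualCone _⟩
      | fin v =>
        obtain ⟨z, hz, u, h⟩ :=
          exists_forall_lagrangian_not_weakLT hF hG hFK hGS hC hA H1 H2 C0 hk hv1
        exact ⟨z, hz, u, h, hbelow z hz u⟩
    · obtain ⟨b, hb, hbw⟩ := hv2 w hvw
      exact not_weakLT_of_mem_dualValues hF hk hw hb hbw

end Duality

/-! ### Stability under subtraction of a continuous linear map -/

section Perturbation

variable {X Y : Type*} [AddCommGroup X] [Module ℝ X] [TopologicalSpace X] [AddCommGroup Y]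
  [Module ℝ Y] [TopologicalSpace Y] {F : X → Extended Y}

lemma dom_perturb (L : X →L[ℝ] Y) : dom (perturb F L) = dom F := by
  ext x
  simp only [dom, perturb, Set.mem_ofPred_eq]
  cases F x with
  | negInf => exact ⟨fun _ => (nomatch ·), fun _ => (nomatch ·)⟩
  | posInf => exact Iff.rfl
  | fin y => exact ⟨fun _ => (nomatch ·), fun _ => (nomatch ·)⟩

lemma perturb_ne_negInf (hF : ∀ x, F x ≠ negInf) (L : X →L[ℝ] Y) (x : X) :
    perturb F L x ≠ negInf := by
  have := hF x
  simp only [perturb]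
  cases h : F x with
  | negInf => exact (this h).elim
  | posInf => exact fun h => by cases h
  | fin y => exact fun h => by cases h

/-- The epigraph of `F - L` is the preimage of that of `F` under the linear map `(x, y) ↦ (x, y + L
x)`. -/
lemma KConvex.perturb {K : Set Y} (hF : KConvex K F) (L : X →L[ℝ] Y) :
    KConvex K (perturb F L) := by
  have : epi K (RVO.perturb F L) =
      ((LinearMap.fst ℝ X Y).prod (LinearMap.snd ℝ X Y + (L : X →ₗ[ℝ] Y) ∘ₗ LinearMap.fst ℝ X Y)) ⁻¹'
        epi K F := by
    ext ⟨x, y⟩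
    refine exists_congr fun c => and_congr_right fun _ => ?_
    change fin y = F x + fin (-(L x)) + fin c ↔ fin (y + L x) = F x + fin c
    cases F x with
    | negInf => exact ⟨(nomatch ·), (nomatch ·)⟩
    | posInf => exact ⟨(nomatch ·), (nomatch ·)⟩
    | fin a =>
      simp only [fin_add_fin, Extended.fin_injective.eq_iff]
      constructor <;> intro h
      · rw [h]; abel
      · rw [← sub_eq_zero] at h ⊢; rw [← h]; abel
  rw [KConvex, this]
  exact hF.linear_preimage _

end Perturbation

end RVO

theorem theorem6p7 {X Y Z U : Type*}
    [AddCommGroup X] [Module ℝ X] [TopologicalSpace X] [IsTopologicalAddGroup X]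
    [ContinuousSMul ℝ X] [LocallyConvexSpace ℝ X] [T2Space X]
    [AddCommGroup Y] [Module ℝ Y] [TopologicalSpace Y] [IsTopologicalAddGroup Y]
    [ContinuousSMul ℝ Y] [LocallyConvexSpace ℝ Y] [T2Space Y]
    [NormedAddCommGroup Z] [NormedSpace ℝ Z]
    [TopologicalSpace U] [CompactSpace U] [Nonempty U]
    (K : ProperCone ℝ Y) (hK : (K : Set Y) ≠ Set.univ)
    (S : ProperCone ℝ Z)
    (C : Set X) (F : X → RVO.Extended Y) (G : U → X → RVO.Extended Z)
    (hF : RVO.IsProper F) (hG : ∀ u, RVO.IsProper (G u))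
    (hA : (RVO.feasibleSet (S : Set Z) C G ∩ RVO.dom F).Nonempty)
    (H0F : RVO.KConvex (K : Set Y) F ∧ RVO.PositivelyLSC (K : Set Y) F)
    (H0G : ∀ u, RVO.KConvex (S : Set Z) (G u) ∧ RVO.KEpiClosed (S : Set Z) (G u))
    (H0C : C.Nonempty ∧ IsClosed C ∧ Convex ℝ C)
    (H1 : RVO.UniformlyConcave (S : Set Z)
      (fun (x : (C ∩ RVO.dom F : Set X)) (u : U) => G u x))
    (H2 : ∀ x ∈ C ∩ RVO.dom F, RVO.UniformlyUSC (S : Set Z) (fun u => G u x))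
    (C0 : ∀ u, ∃ x ∈ C ∩ RVO.dom F, ∃ z, -z ∈ interior (S : Set Z) ∧ G u x = RVO.Extended.fin z)
    (k : Y) (hk : k ∈ interior (K : Set Y)) :
    RVO.StrongStableDuality (K : Set Y) (S : Set Z) C F G k := by
  intro L _
  have hdom := RVO.dom_perturb (F := F) L
  refine RVO.wMax_dualValues_eq (RVO.perturb_ne_negInf hF.2 L) (fun u => (hG u).2)
    (H0F.1.perturb L) (fun u => (H0G u).1) H0C.2.2 ?_ ?_ ?_ ?_ hk
  all_goals rw [hdom]; assumption
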